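/- Let $G$ be a locally compact, second countable (Hausdorff) group with left Haar measure $m$. Let $M(G)$ be the space of complex Borel measures on $G$ and, for a closed set $E\subseteq G$, let $M(E)\subseteq M(G)$ be the set of those measures whose support is contained in $E$. Let $(\lambda_s\xi)(g)=\xi(s^{-1}g)$ be the left regular representation of $G$ on $L^2(G)=L^2(G,m)$; for $\mu\in M(G)$ let $\lambda(\mu)$ be the bounded operator on $L^2(G)$ given by $\lambda(\mu)\xi=\int_G\lambda_s\xi\,d\mu(s)$, and for $f\in L^1(G)$ put $\lambda(f)=\lambda(f\,dm)$. The reduced group $C^*$-algebra $C^*_r(G)$ is the operator-norm closure of $\{\lambda(f): f\in L^1(G)\}$. A closed set $E\subseteq G$ is called a set of extended uniqueness if $\lambda(M(E))\cap C^*_r(G)=\{0\}$, and a set of restricted multiplicity otherwise. (These notions do not depend on the normalization of the Haar measure.) Let $G_1$ and $G_2$ be locally compact second countable groups and let $E_1\subseteq G_1$ and $E_2\subseteq G_2$ be closed sets. Then: (i) if $E_1$ and $E_2$ are sets of restricted multiplicity, then $E_1\times E_2$ is a set of restricted multiplicity in $G_1\times G_2$; (ii) if $E_1$ and $E_2$ are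 sets of extended uniqueness, then $E_1\times E_2$ is a set of extended uniqueness in $G_1\times G_2$. -/

import Mathlib

open MeasureTheory

set_option linter.unusedSectionVars false

noncomputable section

theorem isFiniteMeasure_variation {X : Type*} [MeasurableSpace X] (μ : ComplexMeasure X) :
    IsFiniteMeasure μ.variation := by
  have h : μ.variation ≤
      (ComplexMeasure.re μ).totalVariation + (ComplexMeasure.im μ).totalVariation := by
    refine VectorMeasure.variation_le_of_forall_enorm_le fun E _ => ?_
    have h1 : μ E = ((ComplexMeasure.re μ E : ℝ) : ℂ) +
        ((ComplexMeasure.im μ E : ℝ) : ℂ) * Complex.I :=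
      (Complex.re_add_im (μ E)).symm
    have h2 : ‖((ComplexMeasure.re μ E : ℝ) : ℂ)‖ₑ = ‖ComplexMeasure.re μ E‖ₑ := by
      simp [enorm_eq_nnnorm]
    have h3 : ‖((ComplexMeasure.im μ E : ℝ) : ℂ) * Complex.I‖ₑ = ‖ComplexMeasure.im μ E‖ₑ := by
      simp [enorm_eq_nnnorm]
    rw [h1, Measure.add_apply]
    refine (enorm_add_le _ _).trans ?_
    rw [h2, h3]
    exact add_le_add (SignedMeasure.enorm_le_totalVariation _ _)
      (SignedMeasure.enorm_le_totalVariation _ _)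
  exact isFiniteMeasure_of_le _ h

section RegularRepresentation

variable {G : Type*} [Group G] [TopologicalSpace G] [IsTopologicalGroup G]
  [LocallyCompactSpace G] [SecondCountableTopology G] [MeasurableSpace G] [BorelSpace G]
  (m : Measure G) [m.IsHaarMeasure]

/-- The left regular representation of `G` on `L²(G)`: `(lambda_s ξ)(g) = ξ(s⁻¹ g)`. -/
def leftRegular (s : G) : Lp ℂ 2 m →L[ℂ] Lp ℂ 2 m :=
  (Lp.compMeasurePreservingₗᵢ ℂ (fun g : G => s⁻¹ * g)
    (measurePreserving_mul_left m s⁻¹)).toContinuousLinearMap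

theorem leftRegular_ae_eq (s : G) (ξ : Lp ℂ 2 m) :
    leftRegular m s ξ =ᵐ[m] fun g => ξ (s⁻¹ * g) :=
  Lp.coeFn_compMeasurePreserving ξ (measurePreserving_mul_left m s⁻¹)

theorem norm_leftRegular (s : G) (ξ : Lp ℂ 2 m) : ‖leftRegular m s ξ‖ = ‖ξ‖ :=
  Lp.norm_compMeasurePreserving ξ (measurePreserving_mul_left m s⁻¹)

theorem continuous_leftRegular (ξ : Lp ℂ 2 m) : Continuous fun s : G => leftRegular m s ξ := by
  have h : Continuous fun s : G => (DomMulAct.mk s⁻¹ : Gᵈᵐᵃ) • ξ := by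
    have hs : Continuous fun s : G => (DomMulAct.mk s⁻¹ : Gᵈᵐᵃ) :=
      DomMulAct.continuous_mk.comp continuous_inv
    have : Fact ((2 : ENNReal) ≠ ⊤) := ⟨ENNReal.ofNat_ne_top⟩
    exact hs.smul continuous_const
  exact h

theorem integrable_leftRegular (μ : ComplexMeasure G) (ξ : Lp ℂ 2 m) :
    μ.Integrable fun s => leftRegular m s ξ := by
  have := isFiniteMeasure_variation μ
  refine MeasureTheory.Integrable.of_bound (μ := μ.variation)
    (continuous_leftRegular m ξ).stronglyMeasurable.aestronglyMeasurable ‖ξ‖ ?_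
  exact Filter.Eventually.of_forall fun s => (norm_leftRegular m s ξ).le

/-- The pairing of vectors of `L²(G)` with complex numbers, used to integrate an `L²(G)`-valued
function against a complex measure. -/
def pairing : Lp ℂ 2 m →L[ℝ] ℂ →L[ℝ] Lp ℂ 2 m :=
  (ContinuousLinearMap.lsmul ℝ ℂ).flip

/-- The representation of the complex measures on `L²(G)`:
`lambda(μ) ξ = ∫ lambda_s ξ dμ(s)`, an integral in the Banach space `L²(G)`. -/
def measureOperator (μ : ComplexMeasure G) : Lp ℂ 2 m →L[ℂ] Lp ℂ 2 m :=
  LinearMap.mkContinuous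
    { toFun := fun ξ => μ.integral (fun s => leftRegular m s ξ) (pairing m)
      map_add' := fun ξ η => by
        simp only [map_add]
        exact VectorMeasure.integral_fun_add (integrable_leftRegular m μ ξ)
          (integrable_leftRegular m μ η)
      map_smul' := fun c ξ => by
        simp only [map_smul, RingHom.id_apply]
        refine setToFun_smul (𝕜 := ℂ) _ (fun c s x => ?_) c _
        change μ s • (c • x) = c • (μ s • x)
        exact smul_comm _ _ _ }
    (‖pairing m‖ * μ.variation.real Set.univ)
    (fun ξ => by
      have := isFiniteMeasure_variation μ
      have h := VectorMeasure.norm_integral_le_of_norm_le_const (μ := μ) (B := pairing m)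
        (f := fun s => leftRegular m s ξ) (C := ‖ξ‖)
        (Filter.Eventually.of_forall fun s => (norm_leftRegular m s ξ).le)
      refine h.trans (le_of_eq ?_)
      ring)

/-- The reduced group C*-algebra: the operator-norm closure of `{lambda(f) : f ∈ L¹(G)}`, where
`f ∈ L¹(G)` is identified with the complex measure `f dm`. -/
def reducedCStar : Set (Lp ℂ 2 m →L[ℂ] Lp ℂ 2 m) :=
  closure {T | ∃ f : G → ℂ, Integrable f m ∧ T = measureOperator m (m.withDensityᵥ f)}

/-- `M(E)`: the complex Borel measures (necessarily regular, `G` being locally compact and second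
countable) whose support is contained in `E`. -/
def measuresSupportedOn (E : Set G) : Set (ComplexMeasure G) :=
  {μ | μ.variation.support ⊆ E}

/-- Closed sets of extended uniqueness: `lambda(M(E)) ∩ C*_r(G) = {0}`. -/
def IsExtendedUniquenessSet (E : Set G) : Prop :=
  IsClosed E ∧ measureOperator m '' measuresSupportedOn E ∩ reducedCStar m = {0}

/-- Closed sets of restricted multiplicity (`M₀`-sets): the closed sets which are not of extended
uniqueness. -/
def IsRestrictedMultiplicitySet (E : Set G) : Prop :=
  IsClosed E ∧ ¬ IsExtendedUniquenessSet m E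

end RegularRepresentation

end

/-!
Fix an isometry `W` of the algebraic tensor product `L²(G₁) ⊗ L²(G₂)` onto a dense subspace of
`L²(G₁ × G₂)` which carries `λ_s ⊗ λ_t` to `λ_(s,t)` (`exists_tensor_leftRegular`; the Haar measure
of the product is a multiple `c` of the product of the Haar measures, hence a factor `c^(-1/2)` in
`W`). Every complex measure is written as a density times its variation, so that all identities
between operators `λ(μ)` become, on matrix coefficients, identities between ordinary integrals.

For restricted multiplicity, let `λ(μ₁)` and `λ(μ₂)` be nonzero operators in the reduced
C*-algebras, with `μᵢ` supported on `Eᵢ`. By Fubini, `λ(μ₁ × μ₂) = λ(μ₁) ⊗ λ(μ₂)`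
(`measureOperator_prod`), which is nonzero. If `λ(fₙ) → λ(μ₁)` and `λ(gₙ) → λ(μ₂)` in norm, with
`fₙ` and `gₙ` integrable, then `λ(fₙ ⊗ gₙ) → λ(μ₁ × μ₂)`, because `‖A ⊗ B‖ ≤ ‖A‖ ‖B‖`
(`tensor_mem_reducedCStar`).

For extended uniqueness, let `μ` be supported on `E₁ × E₂` with `λ(μ)` in the reduced C*-algebra.
For `η, ξ ∈ L²(G₂)`, the slice of `λ(μ)` by the functional `⟨η, · ξ⟩` is `λ(μ')`, where `μ'` is the
image of `⟨η, λ_t ξ⟩ dμ(s, t)` under the projection to `G₁` (`slice_measureOperator`). The measure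
`μ'` is supported on `E₁`, and slicing maps the reduced C*-algebra of the product into that of `G₁`
(`slice_mem_reducedCStar`), so the slice vanishes as `E₁` is of extended uniqueness. An operator all
of whose slices vanish is zero (`eq_zero_of_slice_eq_zero`).
-/

/-! ### Complex measures with densities -/

section ComplexMeasures

variable {X : Type*} [MeasurableSpace X]

/-- A complex measure has a density with respect to its own variation, which is a finite positive
measure; every complex measure below is handled through such a density. -/
theorem exists_density_variation (μ : ComplexMeasure X) :
    ∃ h : X → ℂ, Integrable h μ.variation ∧ μ = μ.variation.withDensityᵥ h := by
  have := isFiniteMeasure_variation μ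
  have hac : VectorMeasure.AbsolutelyContinuous μ μ.variation.toENNRealVectorMeasure := by
    intro s hs
    by_cases hm : MeasurableSet s
    · rw [Measure.toENNRealVectorMeasure_apply_measurable hm] at hs
      simpa [hs] using VectorMeasure.enorm_measure_le_variation μ s
    · exact μ.not_measurable hm
  obtain ⟨hre, him⟩ := (ComplexMeasure.absolutelyContinuous_ennreal_iff μ _).1 hac
  have hint := ComplexMeasure.integrable_rnDeriv μ μ.variation
  refine ⟨μ.rnDeriv μ.variation, hint, ?_⟩
  ext s hs : 1
  rw [withDensityᵥ_apply hint hs]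
  apply Complex.ext
  · rw [← RCLike.re_eq_complex_re, ← integral_re hint.integrableOn]
    change ComplexMeasure.re μ s = ∫ x in s, (ComplexMeasure.re μ).rnDeriv μ.variation x ∂_
    rw [← withDensityᵥ_apply (SignedMeasure.integrable_rnDeriv _ _) hs,
      SignedMeasure.withDensityᵥ_rnDeriv_eq _ _ hre]
  · rw [← RCLike.im_eq_complex_im, ← integral_im hint.integrableOn]
    change ComplexMeasure.im μ s = ∫ x in s, (ComplexMeasure.im μ).rnDeriv μ.variation x ∂_
    rw [← withDensityᵥ_apply (SignedMeasure.integrable_rnDeriv _ _) hs,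
      SignedMeasure.withDensityᵥ_rnDeriv_eq _ _ him]

variable {E : Type*} [NormedAddCommGroup E] [NormedSpace ℂ E] [CompleteSpace E]

theorem integral_withDensityᵥ_simpleFunc {ν : Measure X} {h : X → ℂ} (hh : Integrable h ν)
    (f : SimpleFunc X E) :
    (ν.withDensityᵥ h).integral f (ContinuousLinearMap.lsmul ℝ ℂ).flip = ∫ x, h x • f x ∂ν := by
  have hfin := isFiniteMeasure_variation (ν.withDensityᵥ h)
  induction f using SimpleFunc.induction with
  | const c hs =>
    rename_i s
    have e : ⇑(SimpleFunc.piecewise s hs (SimpleFunc.const X c) (SimpleFunc.const X 0)) =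
        s.indicator fun _ => c := by
      ext x
      simp [SimpleFunc.coe_piecewise, Set.piecewise_eq_indicator, Set.indicator]
    have : IsFiniteMeasure ((ν.withDensityᵥ h).restrict s).variation :=
      isFiniteMeasure_variation _
    rw [e, VectorMeasure.integral_indicator hs, VectorMeasure.integral_const,
      VectorMeasure.restrict_apply _ hs MeasurableSet.univ, Set.univ_inter,
      withDensityᵥ_apply hh hs]
    have e2 : (fun x => h x • s.indicator (fun _ => c) x) = s.indicator fun x => h x • c := by
      ext x
      by_cases hx : x ∈ s <;> simp [hx]
    rw [e2, integral_indicator hs, integral_smul_const]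
    rfl
  | add hd hf hg =>
    rename_i f g
    have hi (k : SimpleFunc X E) : Integrable (fun x => h x • k x) ν := by
      obtain ⟨C, hC⟩ := k.exists_forall_norm_le
      exact hh.smul_bdd C k.stronglyMeasurable.aestronglyMeasurable
        (Filter.Eventually.of_forall hC)
    rw [SimpleFunc.coe_add, VectorMeasure.integral_add
      (SimpleFunc.integrable_of_isFiniteMeasure f) (SimpleFunc.integrable_of_isFiniteMeasure g),
      hf, hg, ← integral_add (hi f) (hi g)]
    simp

/-- Integration against a complex measure with a density is integration of the function multiplied
by the density; stated for bounded functions with values in a Banach space. -/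
theorem integral_withDensityᵥ {ν : Measure X} {h : X → ℂ} (hh : Integrable h ν)
    {f : X → E} (hf : StronglyMeasurable f) {C : ℝ} (hC : ∀ x, ‖f x‖ ≤ C) :
    (ν.withDensityᵥ h).integral f (ContinuousLinearMap.lsmul ℝ ℂ).flip = ∫ x, h x • f x ∂ν := by
  have hfin := isFiniteMeasure_variation (ν.withDensityᵥ h)
  rcases isEmpty_or_nonempty X with hX | ⟨⟨x₀⟩⟩
  · simp [VectorMeasure.integral_of_isEmpty, Measure.eq_zero_of_isEmpty ν]
  have hC0 : 0 ≤ C := (norm_nonneg _).trans (hC x₀)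
  have h1 := VectorMeasure.tendsto_integral_of_dominated_convergence (μ := ν.withDensityᵥ h)
    (B := (ContinuousLinearMap.lsmul ℝ ℂ).flip)
    (fun _ => C) (fun n => (hf.approxBounded C n).stronglyMeasurable.aestronglyMeasurable)
    (integrable_const _)
    (fun n => Filter.Eventually.of_forall fun x => hf.norm_approxBounded_le hC0 n x)
    (Filter.Eventually.of_forall fun x => hf.tendsto_approxBounded_of_norm_le (hC x))
  have h2 := tendsto_integral_of_dominated_convergence (μ := ν)
    (F := fun n x => h x • hf.approxBounded C n x) (f := fun x => h x • f x)
    (fun x => ‖h x‖ * C)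
    (fun n => hh.aestronglyMeasurable.smul
      (hf.approxBounded C n).stronglyMeasurable.aestronglyMeasurable)
    (hh.norm.mul_const _)
    (fun n => Filter.Eventually.of_forall fun x => by
      rw [norm_smul]
      exact mul_le_mul_of_nonneg_left (hf.norm_approxBounded_le hC0 n x) (norm_nonneg _))
    (Filter.Eventually.of_forall fun x =>
      (hf.tendsto_approxBounded_of_norm_le (hC x)).const_smul _)
  simp only [integral_withDensityᵥ_simpleFunc hh] at h1
  exact tendsto_nhds_unique h1 h2

end ComplexMeasures

/-! ### Matrix coefficients of `λ(μ)` -/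

section RegularRepresentation

variable {G : Type*} [Group G] [TopologicalSpace G] [IsTopologicalGroup G]
  [LocallyCompactSpace G] [SecondCountableTopology G] [MeasurableSpace G] [BorelSpace G]
  (m : Measure G) [m.IsHaarMeasure]

theorem norm_inner_leftRegular_le (η ξ : Lp ℂ 2 m) (s : G) :
    ‖inner ℂ η (leftRegular m s ξ)‖ ≤ ‖η‖ * ‖ξ‖ :=
  (norm_inner_le_norm _ _).trans_eq (by rw [norm_leftRegular])

theorem continuous_inner_leftRegular (η ξ : Lp ℂ 2 m) :
    Continuous fun s : G => (inner ℂ η (leftRegular m s ξ) : ℂ) :=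
  continuous_const.inner (continuous_leftRegular m ξ)

/-- Matrix coefficients of `λ(μ)` when `μ` is the image under `φ` of a measure with density `k`. -/
theorem inner_measureOperator_map {X : Type*} [MeasurableSpace X] {ν : Measure X} {k : X → ℂ}
    (hk : Integrable k ν) {φ : X → G} (hφ : Measurable φ) (η ξ : Lp ℂ 2 m) :
    inner ℂ η (measureOperator m ((ν.withDensityᵥ k).map φ) ξ) =
      ∫ x, k x * inner ℂ η (leftRegular m (φ x) ξ) ∂ν := by
  have hfin := isFiniteMeasure_variation (ν.withDensityᵥ k)
  have hsm : StronglyMeasurable fun x => leftRegular m (φ x) ξ :=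
    (continuous_leftRegular m ξ).stronglyMeasurable.comp_measurable hφ
  have e : measureOperator m ((ν.withDensityᵥ k).map φ) ξ =
      ∫ x, k x • leftRegular m (φ x) ξ ∂ν := by
    change ((ν.withDensityᵥ k).map φ).integral (fun s => leftRegular m s ξ)
      (ContinuousLinearMap.lsmul ℝ ℂ).flip = _
    rw [VectorMeasure.integral_map hφ
      (continuous_leftRegular m ξ).stronglyMeasurable.aestronglyMeasurable]
    · exact integral_withDensityᵥ hk hsm fun x => (norm_leftRegular m (φ x) ξ).le
    · exact MeasureTheory.Integrable.of_bound (μ := (ν.withDensityᵥ k).variation)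
        hsm.aestronglyMeasurable ‖ξ‖
        (Filter.Eventually.of_forall fun x => (norm_leftRegular m (φ x) ξ).le)
  have hi : Integrable (fun x => k x • leftRegular m (φ x) ξ) ν :=
    hk.smul_bdd ‖ξ‖ hsm.aestronglyMeasurable
      (Filter.Eventually.of_forall fun x => (norm_leftRegular m (φ x) ξ).le)
  rw [e, ← integral_inner hi]
  simp [inner_smul_right]

theorem inner_measureOperator_withDensityᵥ {ν : Measure G} {k : G → ℂ}
    (hk : Integrable k ν) (η ξ : Lp ℂ 2 m) :
    inner ℂ η (measureOperator m (ν.withDensityᵥ k) ξ) =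
      ∫ s, k s * inner ℂ η (leftRegular m s ξ) ∂ν := by
  have h := inner_measureOperator_map m hk measurable_id η ξ
  rwa [VectorMeasure.map_id] at h

theorem measureOperator_zero : measureOperator m (0 : ComplexMeasure G) = 0 := by
  ext1 ξ
  exact VectorMeasure.integral_zero_vectorMeasure

/-- The inclusion which holds for every `E`, so that extended uniqueness is only a matter of the
other one. -/
theorem zero_mem_image_inter_reducedCStar (E : Set G) :
    0 ∈ measureOperator m '' measuresSupportedOn E ∩ reducedCStar m := by
  refine ⟨⟨0, ?_, measureOperator_zero m⟩, subset_closure ⟨0, integrable_zero _ _ _, ?_⟩⟩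
  · simp [measuresSupportedOn]
  · rw [withDensityᵥ_zero, measureOperator_zero]

theorem isExtendedUniquenessSet_iff {E : Set G} (hE : IsClosed E) :
    IsExtendedUniquenessSet m E ↔
      ∀ μ ∈ measuresSupportedOn E, measureOperator m μ ∈ reducedCStar m →
        measureOperator m μ = 0 := by
  refine ⟨fun h μ hμ hr => ?_, fun h => ⟨hE, Set.Subset.antisymm ?_ ?_⟩⟩
  · have : measureOperator m μ ∈ measureOperator m '' measuresSupportedOn E ∩ reducedCStar m :=
      ⟨⟨μ, hμ, rfl⟩, hr⟩
    rwa [h.2] at this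
  · rintro _ ⟨⟨μ, hμ, rfl⟩, hr⟩
    exact h μ hμ hr
  · rintro _ rfl
    exact zero_mem_image_inter_reducedCStar m E

theorem mem_measuresSupportedOn_iff {E : Set G} (hE : IsClosed E) (μ : ComplexMeasure G) :
    μ ∈ measuresSupportedOn E ↔ μ.variation Eᶜ = 0 :=
  ⟨fun h => measure_mono_null (Set.compl_subset_compl.2 h) Measure.measure_compl_support,
    fun h => Measure.support_subset_of_isClosed hE h⟩

end RegularRepresentation

/-! ### The tensor product decomposition of `L²` of a product -/

section ProductL2
open scoped TensorProduct

variable {X Y : Type*} [MeasurableSpace X] [MeasurableSpace Y] {μ : Measure X} {ν : Measure Y}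
  [SigmaFinite μ] [SigmaFinite ν]

theorem memLp_two_mul_prod (x : Lp ℂ 2 μ) (y : Lp ℂ 2 ν) :
    MemLp (fun p : X × Y => x p.1 * y p.2) 2 (μ.prod ν) := by
  have hm : AEStronglyMeasurable (fun p : X × Y => x p.1 * y p.2) (μ.prod ν) :=
    (Lp.aestronglyMeasurable x).comp_fst.mul (Lp.aestronglyMeasurable y).comp_snd
  rw [memLp_two_iff_integrable_sq_norm hm]
  have h := ((memLp_two_iff_integrable_sq_norm (Lp.aestronglyMeasurable x)).1 (Lp.memLp x)).mul_prod
    ((memLp_two_iff_integrable_sq_norm (Lp.aestronglyMeasurable y)).1 (Lp.memLp y))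
  simpa only [norm_mul, mul_pow] using h

/-- The elementary tensor `(s, t) ↦ x(s) y(t)` in `L²(μ × ν)`. -/
noncomputable def prodMul (x : Lp ℂ 2 μ) (y : Lp ℂ 2 ν) : Lp ℂ 2 (μ.prod ν) :=
  (memLp_two_mul_prod x y).toLp _

theorem prodMul_ae_eq (x : Lp ℂ 2 μ) (y : Lp ℂ 2 ν) :
    prodMul x y =ᵐ[μ.prod ν] fun p => x p.1 * y p.2 :=
  MemLp.coeFn_toLp _

theorem ae_fst_prod {f g : X → ℂ} (h : f =ᵐ[μ] g) :
    (fun p : X × Y => f p.1) =ᵐ[μ.prod ν] fun p => g p.1 :=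
  Measure.quasiMeasurePreserving_fst.ae_eq_comp h

theorem ae_snd_prod {f g : Y → ℂ} (h : f =ᵐ[ν] g) :
    (fun p : X × Y => f p.2) =ᵐ[μ.prod ν] fun p => g p.2 :=
  Measure.quasiMeasurePreserving_snd.ae_eq_comp h

theorem inner_prodMul (x x' : Lp ℂ 2 μ) (y y' : Lp ℂ 2 ν) :
    inner ℂ (prodMul x y) (prodMul x' y') = inner ℂ x x' * (inner ℂ y y' : ℂ) := by
  rw [L2.inner_def, L2.inner_def, L2.inner_def, ← integral_prod_mul]
  refine integral_congr_ae ?_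
  filter_upwards [prodMul_ae_eq x y, prodMul_ae_eq x' y'] with p h h'
  rw [h, h']
  simp only [RCLike.inner_apply, map_mul]
  ring

/-- The isometric embedding of the algebraic tensor product `L²(μ) ⊗ L²(ν)` into `L²(μ × ν)`. -/
noncomputable def tensorToProd : Lp ℂ 2 μ ⊗[ℂ] Lp ℂ 2 ν →ₗᵢ[ℂ] Lp ℂ 2 (μ.prod ν) :=
  (TensorProduct.lift (LinearMap.mk₂ ℂ (prodMul (μ := μ) (ν := ν))
    (fun x x' y => by
      apply Lp.ext
      filter_upwards [prodMul_ae_eq (x + x') y, prodMul_ae_eq x y, prodMul_ae_eq x' y,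
        ae_fst_prod (ν := ν) (Lp.coeFn_add x x'), Lp.coeFn_add (prodMul x y) (prodMul x' y)]
        with p h1 h2 h3 h4 h5
      simp only [Pi.add_apply] at h4 h5
      rw [h1, h4, h5, h2, h3, add_mul])
    (fun c x y => by
      apply Lp.ext
      filter_upwards [prodMul_ae_eq (c • x) y, prodMul_ae_eq x y,
        ae_fst_prod (ν := ν) (Lp.coeFn_smul c x), Lp.coeFn_smul c (prodMul x y)] with p h1 h2 h3 h4
      simp only [Pi.smul_apply, smul_eq_mul] at h3 h4
      rw [h1, h3, h4, h2, mul_assoc])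
    (fun x y y' => by
      apply Lp.ext
      filter_upwards [prodMul_ae_eq x (y + y'), prodMul_ae_eq x y, prodMul_ae_eq x y',
        ae_snd_prod (μ := μ) (Lp.coeFn_add y y'), Lp.coeFn_add (prodMul x y) (prodMul x y')]
        with p h1 h2 h3 h4 h5
      simp only [Pi.add_apply] at h4 h5
      rw [h1, h4, h5, h2, h3, mul_add])
    (fun c x y => by
      apply Lp.ext
      filter_upwards [prodMul_ae_eq x (c • y), prodMul_ae_eq x y,
        ae_snd_prod (μ := μ) (Lp.coeFn_smul c y), Lp.coeFn_smul c (prodMul x y)] with p h1 h2 h3 h4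
      simp only [Pi.smul_apply, smul_eq_mul] at h3 h4
      rw [h1, h3, h4, h2, mul_left_comm]))).isometryOfInner fun u v => by
    induction u using TensorProduct.induction_on with
    | zero => simp
    | add u u' hu hu' => simp only [map_add, inner_add_left, hu, hu']
    | tmul x y =>
      induction v using TensorProduct.induction_on with
      | zero => simp
      | add v v' hv hv' => simp only [map_add, inner_add_right, hv, hv']
      | tmul x' y' =>
        rw [TensorProduct.inner_tmul]
        exact inner_prodMul x x' y y'

theorem tensorToProd_tmul (x : Lp ℂ 2 μ) (y : Lp ℂ 2 ν) :
    tensorToProd (x ⊗ₜ[ℂ] y) = prodMul x y := rfl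

theorem prodMul_indicatorConstLp {A : Set X} (hA : MeasurableSet A) (hμA : μ A ≠ ⊤)
    {B : Set Y} (hB : MeasurableSet B) (hνB : ν B ≠ ⊤) (hAB : μ.prod ν (A ×ˢ B) ≠ ⊤) :
    prodMul (indicatorConstLp 2 hA hμA (1 : ℂ)) (indicatorConstLp 2 hB hνB (1 : ℂ)) =
      indicatorConstLp 2 (hA.prod hB) hAB 1 := by
  apply Lp.ext
  filter_upwards [prodMul_ae_eq (indicatorConstLp 2 hA hμA (1 : ℂ))
      (indicatorConstLp 2 hB hνB (1 : ℂ)),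
    ae_fst_prod (ν := ν) (indicatorConstLp_coeFn (p := 2) (hs := hA) (hμs := hμA) (c := (1 : ℂ))),
    ae_snd_prod (μ := μ) (indicatorConstLp_coeFn (p := 2) (hs := hB) (hμs := hνB) (c := (1 : ℂ))),
    indicatorConstLp_coeFn (p := 2) (hs := hA.prod hB) (hμs := hAB) (c := (1 : ℂ))]
    with p h1 h2 h3 h4
  rw [h1, h2, h3, h4]
  by_cases ha : p.1 ∈ A <;> by_cases hb : p.2 ∈ B <;> simp [Set.indicator, ha, hb]

/-- A function in `L²(μ × ν)` whose integrals over all rectangles of finite sides vanish is zero: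
restricted to such a rectangle, it is the density of a complex measure which vanishes on the
π-system of measurable rectangles. -/
theorem eq_zero_of_inner_prodMul_eq_zero (ζ : Lp ℂ 2 (μ.prod ν))
    (h : ∀ x y, inner ℂ (prodMul x y) ζ = (0 : ℂ)) : ζ = 0 := by
  have hrect : ∀ A B, MeasurableSet A → MeasurableSet B → μ A ≠ ⊤ → ν B ≠ ⊤ →
      ∫ p in A ×ˢ B, ζ p ∂(μ.prod ν) = 0 := by
    intro A B hA hB hμA hνB
    have hAB : μ.prod ν (A ×ˢ B) ≠ ⊤ := by
      rw [Measure.prod_prod]; exact ENNReal.mul_ne_top hμA hνB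
    have := h (indicatorConstLp 2 hA hμA (1 : ℂ)) (indicatorConstLp 2 hB hνB (1 : ℂ))
    rw [prodMul_indicatorConstLp hA hμA hB hνB hAB,
      L2.inner_indicatorConstLp_eq_inner_setIntegral] at this
    simpa using this
  have hS (n : ℕ) :
      ∀ᵐ p ∂((μ.prod ν).restrict (spanningSets μ n ×ˢ spanningSets ν n)), ζ p = 0 := by
    set S := spanningSets μ n
    set T := spanningSets ν n
    have hSm : MeasurableSet S := measurableSet_spanningSets μ n
    have hTm : MeasurableSet T := measurableSet_spanningSets ν n
    have hSf : μ S ≠ ⊤ := (measure_spanningSets_lt_top μ n).ne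
    have hTf : ν T ≠ ⊤ := (measure_spanningSets_lt_top ν n).ne
    have hST : μ.prod ν (S ×ˢ T) ≠ ⊤ := by
      rw [Measure.prod_prod]; exact ENNReal.mul_ne_top hSf hTf
    have hint : Integrable ζ ((μ.prod ν).restrict (S ×ˢ T)) :=
      integrableOn_Lp_of_measure_ne_top ζ (by norm_num) hST
    have hval : ∀ A B, MeasurableSet A → MeasurableSet B →
        ((μ.prod ν).restrict (S ×ˢ T)).withDensityᵥ ζ (A ×ˢ B) = 0 := by
      intro A B hA hB
      rw [withDensityᵥ_apply hint (hA.prod hB), Measure.restrict_restrict (hA.prod hB),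
        Set.prod_inter_prod]
      exact hrect _ _ (hA.inter hSm) (hB.inter hTm)
        (measure_ne_top_of_subset Set.inter_subset_right hSf)
        (measure_ne_top_of_subset Set.inter_subset_right hTf)
    have hz : ((μ.prod ν).restrict (S ×ˢ T)).withDensityᵥ ζ =
        ((μ.prod ν).restrict (S ×ˢ T)).withDensityᵥ (0 : X × Y → ℂ) := by
      rw [withDensityᵥ_zero]
      refine VectorMeasure.ext_of_generateFrom _ ?_ generateFrom_prod.symm isPiSystem_prod ?_
      · rintro _ ⟨A, hA, B, hB, rfl⟩
        exact hval A B hA hB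
      · rw [← Set.univ_prod_univ]
        exact hval _ _ MeasurableSet.univ MeasurableSet.univ
    exact hint.ae_eq_of_withDensityᵥ_eq (integrable_zero _ _ _) hz
  have hU : (⋃ n, spanningSets μ n ×ˢ spanningSets ν n) = Set.univ := by
    rw [Set.iUnion_prod_of_monotone (monotone_spanningSets μ) (monotone_spanningSets ν),
      iUnion_spanningSets, iUnion_spanningSets, Set.univ_prod_univ]
  rw [Lp.eq_zero_iff_ae_eq_zero]
  have := ae_restrict_iUnion_iff (fun n => spanningSets μ n ×ˢ spanningSets ν n)
    (fun p => ζ p = 0) |>.2 hS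
  rwa [hU, Measure.restrict_univ] at this

theorem denseRange_tensorToProd : DenseRange (tensorToProd (μ := μ) (ν := ν)) := by
  have h :
      (LinearMap.range (tensorToProd (μ := μ) (ν := ν)).toLinearMap).topologicalClosure = ⊤ := by
    rw [Submodule.topologicalClosure_eq_top_iff, Submodule.eq_bot_iff]
    intro ζ hζ
    refine eq_zero_of_inner_prodMul_eq_zero ζ fun x y => ?_
    exact (Submodule.mem_orthogonal _ _).1 hζ _ ⟨x ⊗ₜ y, rfl⟩
  exact Submodule.dense_iff_topologicalClosure_eq_top.2 h

end ProductL2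

/-! ### Rescaling the measure -/

section ScaleL2
open scoped NNReal

variable {X : Type*} [MeasurableSpace X] {μ : Measure X}

theorem ae_nnreal_smul_measure_eq {c : ℝ≥0} (hc : c ≠ 0) : ae (c • μ) = ae μ :=
  Measure.ae_smul_measure_eq (R := ℝ≥0) hc μ

theorem memLp_scale (c : ℝ≥0) (ξ : Lp ℂ 2 μ) :
    MemLp ((((Real.sqrt c)⁻¹ : ℝ) : ℂ) • (ξ : X → ℂ)) 2 (c • μ) :=
  ((Lp.memLp ξ).smul_measure ENNReal.coe_ne_top).const_smul _

/-- The unitary `ξ ↦ c^(-1/2) ξ` from `L²(μ)` to `L²(c μ)`. -/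
noncomputable def scaleL2 (μ : Measure X) {c : ℝ≥0} (hc : c ≠ 0) : Lp ℂ 2 μ →ₗᵢ[ℂ] Lp ℂ 2 (c • μ) :=
  LinearMap.isometryOfInner
    { toFun := fun ξ => (memLp_scale c ξ).toLp _
      map_add' := fun ξ η => by
        rw [← MemLp.toLp_add]
        refine MemLp.toLp_congr _ _ ?_
        rw [Filter.EventuallyEq, ae_nnreal_smul_measure_eq hc]
        filter_upwards [Lp.coeFn_add ξ η] with p hp
        rw [Pi.smul_apply, hp]
        simp [mul_add]
      map_smul' := fun z ξ => by
        rw [RingHom.id_apply, ← MemLp.toLp_const_smul]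
        refine MemLp.toLp_congr _ _ ?_
        rw [Filter.EventuallyEq, ae_nnreal_smul_measure_eq hc]
        filter_upwards [Lp.coeFn_smul z ξ] with p hp
        simp [hp, mul_left_comm] }
    fun ξ η => by
      have hc' : (c : ℝ) ≠ 0 := by exact_mod_cast hc
      have h : (((Real.sqrt c)⁻¹ : ℝ) : ℂ) * (((Real.sqrt c)⁻¹ : ℝ) : ℂ) = ((c : ℝ) : ℂ)⁻¹ := by
        rw [← Complex.ofReal_mul, ← mul_inv, Real.mul_self_sqrt c.coe_nonneg, Complex.ofReal_inv]
      rw [L2.inner_def, L2.inner_def]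
      have e : ∀ᵐ p ∂(c • μ), inner ℂ ((memLp_scale c ξ).toLp _ p) ((memLp_scale c η).toLp _ p) =
          ((c : ℝ) : ℂ)⁻¹ * inner ℂ (ξ p) (η p) := by
        filter_upwards [(memLp_scale c ξ).coeFn_toLp, (memLp_scale c η).coeFn_toLp] with p h1 h2
        rw [h1, h2, Pi.smul_apply, Pi.smul_apply, inner_smul_left, inner_smul_right,
          Complex.conj_ofReal, ← mul_assoc, h]
      refine (integral_congr_ae e).trans ?_
      rw [integral_const_mul, integral_smul_nnreal_measure, NNReal.smul_def, Complex.real_smul,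
        inv_mul_cancel_left₀ (Complex.ofReal_ne_zero.2 hc')]

theorem scaleL2_ae_eq {c : ℝ≥0} (hc : c ≠ 0) (ξ : Lp ℂ 2 μ) :
    scaleL2 μ hc ξ =ᵐ[μ] fun p => (((Real.sqrt c)⁻¹ : ℝ) : ℂ) * ξ p := by
  have h := (memLp_scale c ξ).coeFn_toLp
  rwa [Filter.EventuallyEq, ae_nnreal_smul_measure_eq hc] at h

theorem scaleL2_surjective {c : ℝ≥0} (hc : c ≠ 0) : Function.Surjective (scaleL2 μ hc) := by
  intro ζ
  have hs : ((Real.sqrt c : ℝ) : ℂ) ≠ 0 :=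
    Complex.ofReal_ne_zero.2 (Real.sqrt_ne_zero'.2 (NNReal.coe_pos.2 (pos_iff_ne_zero.2 hc)))
  have hm : MemLp (((Real.sqrt c : ℝ) : ℂ) • (ζ : X → ℂ)) 2 μ := by
    refine (MemLp.of_measure_le_smul (c := ((c⁻¹ : ℝ≥0) : ENNReal)) ENNReal.coe_ne_top ?_
      (Lp.memLp ζ)).const_smul _
    change μ ≤ (c⁻¹ : ℝ≥0) • (c • μ)
    rw [smul_smul, inv_mul_cancel₀ hc, one_smul]
  refine ⟨hm.toLp _, Lp.ext ?_⟩
  rw [Filter.EventuallyEq, ae_nnreal_smul_measure_eq hc]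
  filter_upwards [scaleL2_ae_eq hc (hm.toLp _), hm.coeFn_toLp] with p h1 h2
  rw [h1, h2, Pi.smul_apply, smul_eq_mul, Complex.ofReal_inv, inv_mul_cancel_left₀ hs]

end ScaleL2

/-! ### The regular representation of a product group -/

section Product
open scoped TensorProduct NNReal

variable {G₁ : Type*} [Group G₁] [TopologicalSpace G₁] [IsTopologicalGroup G₁]
  [LocallyCompactSpace G₁] [SecondCountableTopology G₁] [MeasurableSpace G₁] [BorelSpace G₁]
  {G₂ : Type*} [Group G₂] [TopologicalSpace G₂] [IsTopologicalGroup G₂]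
  [LocallyCompactSpace G₂] [SecondCountableTopology G₂] [MeasurableSpace G₂] [BorelSpace G₂]
  (m₁ : Measure G₁) [m₁.IsHaarMeasure] (m₂ : Measure G₂) [m₂.IsHaarMeasure]
  (m : Measure (G₁ × G₂)) [m.IsHaarMeasure]

theorem leftRegular_prodMul (s : G₁) (t : G₂) (x : Lp ℂ 2 m₁) (y : Lp ℂ 2 m₂) :
    leftRegular (m₁.prod m₂) (s, t) (prodMul x y) =
      prodMul (leftRegular m₁ s x) (leftRegular m₂ t y) := by
  apply Lp.ext
  filter_upwards [leftRegular_ae_eq (m₁.prod m₂) (s, t) (prodMul x y),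
    (measurePreserving_mul_left (m₁.prod m₂) (s, t)⁻¹).quasiMeasurePreserving.ae_eq_comp
      (prodMul_ae_eq x y),
    prodMul_ae_eq (leftRegular m₁ s x) (leftRegular m₂ t y),
    ae_fst_prod (ν := m₂) (leftRegular_ae_eq m₁ s x),
    ae_snd_prod (μ := m₁) (leftRegular_ae_eq m₂ t y)] with p h1 h2 h3 h4 h5
  rw [h1, h3, h4, h5]
  exact h2

theorem leftRegular_scaleL2 {G : Type*} [Group G] [TopologicalSpace G] [IsTopologicalGroup G]
    [LocallyCompactSpace G] [SecondCountableTopology G] [MeasurableSpace G] [BorelSpace G]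
    (m : Measure G) [m.IsHaarMeasure] {c : ℝ≥0} (hc : c ≠ 0) [(c • m).IsHaarMeasure]
    (s : G) (ξ : Lp ℂ 2 m) :
    leftRegular (c • m) s (scaleL2 m hc ξ) = scaleL2 m hc (leftRegular m s ξ) := by
  have h := leftRegular_ae_eq (c • m) s (scaleL2 m hc ξ)
  apply Lp.ext
  rw [Filter.EventuallyEq, ae_nnreal_smul_measure_eq hc] at h ⊢
  filter_upwards [h, (measurePreserving_mul_left m s⁻¹).quasiMeasurePreserving.ae_eq_comp
      (scaleL2_ae_eq hc ξ), scaleL2_ae_eq hc (leftRegular m s ξ), leftRegular_ae_eq m s ξ]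
    with p h1 h2 h3 h4
  rw [h1, h3, h4]
  exact h2

theorem exists_smul_prod_eq : ∃ c : ℝ≥0, c ≠ 0 ∧ m = c • m₁.prod m₂ :=
  ⟨_, (Measure.haarScalarFactor_pos_of_isHaarMeasure m (m₁.prod m₂)).ne',
    Measure.isMulLeftInvariant_eq_smul m (m₁.prod m₂)⟩

/-- Up to the normalization of Haar measure, `L²(G₁ × G₂)` is the Hilbert space tensor product of
`L²(G₁)` and `L²(G₂)`, and the left regular representation is the tensor product representation. -/
theorem exists_tensor_leftRegular :
    ∃ W : Lp ℂ 2 m₁ ⊗[ℂ] Lp ℂ 2 m₂ →ₗᵢ[ℂ] Lp ℂ 2 m, DenseRange W ∧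
      ∀ s t x y, leftRegular m (s, t) (W (x ⊗ₜ y)) =
        W (leftRegular m₁ s x ⊗ₜ leftRegular m₂ t y) := by
  obtain ⟨c, hc, rfl⟩ := exists_smul_prod_eq m₁ m₂ m
  refine ⟨(scaleL2 (m₁.prod m₂) hc).comp tensorToProd, ?_, fun s t x y => ?_⟩
  · exact (scaleL2_surjective hc).denseRange.comp denseRange_tensorToProd
      (scaleL2 (m₁.prod m₂) hc).continuous
  · change leftRegular _ _ (scaleL2 _ hc (prodMul x y)) = scaleL2 _ hc (prodMul _ _)
    rw [leftRegular_scaleL2, leftRegular_prodMul]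

end Product

/-! ### Tensor products of operators and slice maps -/

section TensorEmbedding
open scoped TensorProduct

variable {H₁ H₂ K : Type*} [NormedAddCommGroup H₁] [InnerProductSpace ℂ H₁]
  [NormedAddCommGroup H₂] [InnerProductSpace ℂ H₂] [NormedAddCommGroup K] [InnerProductSpace ℂ K]
  {W : H₁ ⊗[ℂ] H₂ →ₗᵢ[ℂ] K}

theorem eq_of_inner_tmul_eq (hW : DenseRange W) {ζ ζ' : K}
    (h : ∀ u v, (inner ℂ (W (u ⊗ₜ v)) ζ : ℂ) = inner ℂ (W (u ⊗ₜ v)) ζ') : ζ = ζ' := by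
  have h1 : ∀ w, (inner ℂ (W w) ζ : ℂ) = inner ℂ (W w) ζ' := by
    intro w
    induction w using TensorProduct.induction_on with
    | zero => simp
    | tmul u v => exact h u v
    | add a b ha hb => rw [map_add, inner_add_left, inner_add_left, ha, hb]
  have h2 : (fun z : K => (inner ℂ z ζ : ℂ)) = fun z => inner ℂ z ζ' :=
    hW.equalizer (by fun_prop) (by fun_prop) (funext h1)
  exact ext_inner_left ℂ fun z => congrFun h2 z

/-- On the range of `W`, an operator is determined by its values at the elementary tensors. -/
theorem comp_eq_of_tmul_eq {C : K →L[ℂ] K} {D : H₁ ⊗[ℂ] H₂ →L[ℂ] K}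
    (h : ∀ x y, C (W (x ⊗ₜ y)) = D (x ⊗ₜ y)) (w : H₁ ⊗[ℂ] H₂) : C (W w) = D w := by
  induction w using TensorProduct.induction_on with
  | zero => simp
  | tmul u v => exact h u v
  | add a b ha hb => rw [map_add, map_add, map_add, ha, hb]

theorem opNorm_le_of_denseRange (hW : DenseRange W) {C : K →L[ℂ] K} {M : ℝ} (hM : 0 ≤ M)
    (h : ∀ w, ‖C (W w)‖ ≤ M * ‖w‖) : ‖C‖ ≤ M := by
  refine C.opNorm_le_bound hM fun z => ?_
  refine hW.induction_on (p := fun z => ‖C z‖ ≤ M * ‖z‖) z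
    (isClosed_le (by fun_prop) (by fun_prop)) fun w => ?_
  rw [W.norm_map]
  exact h w

/-- The Hilbert space tensor product of operators is jointly continuous in norm. The tensor product
of `A` and `B` is described here as the operator `C` on `K` with `C (W (x ⊗ y)) = W (A x ⊗ B y)`. -/
theorem tendsto_of_tensor (hW : DenseRange W) {A : ℕ → H₁ →L[ℂ] H₁} {A₀ : H₁ →L[ℂ] H₁}
    {B : ℕ → H₂ →L[ℂ] H₂} {B₀ : H₂ →L[ℂ] H₂} {C : ℕ → K →L[ℂ] K} {C₀ : K →L[ℂ] K}
    (hA : Filter.Tendsto A Filter.atTop (nhds A₀)) (hB : Filter.Tendsto B Filter.atTop (nhds B₀))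
    (hC : ∀ n x y, C n (W (x ⊗ₜ y)) = W (A n x ⊗ₜ B n y))
    (hC₀ : ∀ x y, C₀ (W (x ⊗ₜ y)) = W (A₀ x ⊗ₜ B₀ y)) :
    Filter.Tendsto C Filter.atTop (nhds C₀) := by
  rw [tendsto_iff_norm_sub_tendsto_zero] at hA ⊢
  have hB' := tendsto_iff_norm_sub_tendsto_zero.1 hB
  have hlim := (hA.mul hB.norm).add (hB'.const_mul ‖A₀‖)
  rw [zero_mul, mul_zero, add_zero] at hlim
  refine squeeze_zero (fun _ => norm_nonneg _) (fun n => ?_) hlim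
  refine opNorm_le_of_denseRange hW (by positivity) fun w => ?_
  -- `Aₙ ⊗ Bₙ - A₀ ⊗ B₀ = (Aₙ - A₀) ⊗ Bₙ + A₀ ⊗ (Bₙ - B₀)`
  set D := TensorProduct.mapL (A n - A₀) (B n) + TensorProduct.mapL A₀ (B n - B₀)
  have e : (C n - C₀) (W w) = (W.toContinuousLinearMap ∘L D) w := by
    refine comp_eq_of_tmul_eq (fun x y => ?_) w
    change C n (W (x ⊗ₜ y)) - C₀ (W (x ⊗ₜ y)) =
      W ((A n x - A₀ x) ⊗ₜ B n y + A₀ x ⊗ₜ (B n y - B₀ y))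
    rw [hC, hC₀, ← map_sub]
    congr 1
    rw [TensorProduct.sub_tmul, TensorProduct.tmul_sub]
    abel
  rw [e]
  change ‖W (D w)‖ ≤ _
  rw [W.norm_map]
  refine (D.le_opNorm w).trans (mul_le_mul_of_nonneg_right ?_ (norm_nonneg _))
  exact (norm_add_le _ _).trans
    (add_le_add (TensorProduct.norm_mapL_le _ _) (TensorProduct.norm_mapL_le _ _))

/-- The bounded operator `x ↦ x ⊗ ξ` from `H₁` to the space `K` in which `W` realizes the tensor
product. -/
noncomputable def tensorRight (W : H₁ ⊗[ℂ] H₂ →ₗᵢ[ℂ] K) (ξ : H₂) : H₁ →L[ℂ] K :=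
  LinearMap.mkContinuous
    { toFun := fun x => W (x ⊗ₜ ξ)
      map_add' := fun x y => by rw [TensorProduct.add_tmul, map_add]
      map_smul' := fun c x => by rw [← TensorProduct.smul_tmul', map_smul, RingHom.id_apply] }
    ‖ξ‖ fun x => by
      change ‖W (x ⊗ₜ ξ)‖ ≤ _
      rw [W.norm_map, TensorProduct.norm_tmul, mul_comm]

variable [CompleteSpace H₁] [CompleteSpace K]

/-- The slice map `C ↦ (id ⊗ ω)(C)`, where `ω` is the vector functional `D ↦ ⟨η, D ξ⟩`. -/
noncomputable def slice (W : H₁ ⊗[ℂ] H₂ →ₗᵢ[ℂ] K) (η ξ : H₂) (C : K →L[ℂ] K) : H₁ →L[ℂ] H₁ :=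
  (tensorRight W η).adjoint ∘L C ∘L tensorRight W ξ

theorem continuous_slice (η ξ : H₂) : Continuous (slice W η ξ) := by
  unfold slice
  fun_prop

theorem inner_slice (η ξ : H₂) (C : K →L[ℂ] K) (u x : H₁) :
    (inner ℂ u (slice W η ξ C x) : ℂ) = inner ℂ (W (u ⊗ₜ η)) (C (W (x ⊗ₜ ξ))) := by
  rw [slice, ContinuousLinearMap.comp_apply, ContinuousLinearMap.adjoint_inner_right]
  rfl

theorem eq_zero_of_slice_eq_zero (hW : DenseRange W) {C : K →L[ℂ] K}
    (h : ∀ η ξ, slice W η ξ C = 0) : C = 0 := by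
  ext1 z
  refine congrFun (hW.equalizer (g := C) (h := fun _ => (0 : K)) C.continuous continuous_const ?_) z
  funext w
  refine comp_eq_of_tmul_eq (D := 0) (fun x ξ => eq_of_inner_tmul_eq hW fun u η => ?_) w
  rw [← inner_slice, h]
  simp

end TensorEmbedding

/-! ### Measure operators on a product group -/

section Product
open scoped TensorProduct NNReal

variable {G₁ : Type*} [Group G₁] [TopologicalSpace G₁] [IsTopologicalGroup G₁]
  [LocallyCompactSpace G₁] [SecondCountableTopology G₁] [MeasurableSpace G₁] [BorelSpace G₁]
  {G₂ : Type*} [Group G₂] [TopologicalSpace G₂] [IsTopologicalGroup G₂]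
  [LocallyCompactSpace G₂] [SecondCountableTopology G₂] [MeasurableSpace G₂] [BorelSpace G₂]
  {m₁ : Measure G₁} [m₁.IsHaarMeasure] {m₂ : Measure G₂} [m₂.IsHaarMeasure]
  {m : Measure (G₁ × G₂)} [m.IsHaarMeasure]
  {W : Lp ℂ 2 m₁ ⊗[ℂ] Lp ℂ 2 m₂ →ₗᵢ[ℂ] Lp ℂ 2 m}

theorem inner_leftRegular_tmul
    (hWl : ∀ s t x y, leftRegular m (s, t) (W (x ⊗ₜ y)) =
      W (leftRegular m₁ s x ⊗ₜ leftRegular m₂ t y))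
    (p : G₁ × G₂) (u x : Lp ℂ 2 m₁) (v y : Lp ℂ 2 m₂) :
    (inner ℂ (W (u ⊗ₜ v)) (leftRegular m p (W (x ⊗ₜ y))) : ℂ) =
      inner ℂ u (leftRegular m₁ p.1 x) * inner ℂ v (leftRegular m₂ p.2 y) := by
  rw [← TensorProduct.inner_tmul, ← W.inner_map_map, ← hWl]

theorem integrable_mul_inner_leftRegular_snd {ν : Measure (G₁ × G₂)} {h : G₁ × G₂ → ℂ}
    (hh : Integrable h ν) (η ξ : Lp ℂ 2 m₂) :
    Integrable (fun p => h p * inner ℂ η (leftRegular m₂ p.2 ξ)) ν :=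
  hh.mul_bdd (c := ‖η‖ * ‖ξ‖)
    ((continuous_inner_leftRegular m₂ η ξ).comp continuous_snd).aestronglyMeasurable
    (Filter.Eventually.of_forall fun p => norm_inner_leftRegular_le m₂ η ξ p.2)

/-- `λ(μ₁ × μ₂) = λ(μ₁) ⊗ λ(μ₂)` for complex measures `μᵢ` with densities `hᵢ`: both sides have the
same matrix coefficients by Fubini. -/
theorem measureOperator_prod (hW : DenseRange W)
    (hWl : ∀ s t x y, leftRegular m (s, t) (W (x ⊗ₜ y)) =
      W (leftRegular m₁ s x ⊗ₜ leftRegular m₂ t y))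
    {ν₁ : Measure G₁} {ν₂ : Measure G₂} [SigmaFinite ν₁] [SigmaFinite ν₂] {h₁ : G₁ → ℂ}
    {h₂ : G₂ → ℂ} (hh₁ : Integrable h₁ ν₁) (hh₂ : Integrable h₂ ν₂)
    (x : Lp ℂ 2 m₁) (y : Lp ℂ 2 m₂) :
    measureOperator m ((ν₁.prod ν₂).withDensityᵥ fun p => h₁ p.1 * h₂ p.2) (W (x ⊗ₜ y)) =
      W (measureOperator m₁ (ν₁.withDensityᵥ h₁) x ⊗ₜ
        measureOperator m₂ (ν₂.withDensityᵥ h₂) y) := by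
  refine eq_of_inner_tmul_eq hW fun u v => ?_
  rw [inner_measureOperator_withDensityᵥ m (hh₁.mul_prod hh₂), W.inner_map_map,
    TensorProduct.inner_tmul, inner_measureOperator_withDensityᵥ m₁ hh₁,
    inner_measureOperator_withDensityᵥ m₂ hh₂, ← integral_prod_mul]
  refine integral_congr_ae (Filter.Eventually.of_forall fun p => ?_)
  simp only [inner_leftRegular_tmul hWl]
  ring

theorem withDensityᵥ_smul_measure {X : Type*} [MeasurableSpace X] {μ : Measure X} {c : ℝ≥0}
    (hc : c ≠ 0) {f : X → ℂ} (hf : Integrable f μ) :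
    (c • μ).withDensityᵥ (fun x => ((c : ℝ) : ℂ)⁻¹ * f x) = μ.withDensityᵥ f := by
  have hc' : ((c : ℝ) : ℂ) ≠ 0 := by exact_mod_cast hc
  have hi : Integrable (fun x => ((c : ℝ) : ℂ)⁻¹ * f x) (c • μ) :=
    (hf.const_mul _).smul_measure_nnreal
  ext s hs : 1
  rw [withDensityᵥ_apply hi hs, withDensityᵥ_apply hf hs, Measure.restrict_smul,
    integral_smul_nnreal_measure, integral_const_mul, NNReal.smul_def, Complex.real_smul,
    mul_inv_cancel_left₀ hc']

/-- The slice of `λ(μ)` by `⟨η, · ξ⟩` is again the operator of a complex measure: the image under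
the first projection of `⟨η, λ_t ξ⟩ dμ(s, t)`. -/
theorem slice_measureOperator
    (hWl : ∀ s t x y, leftRegular m (s, t) (W (x ⊗ₜ y)) =
      W (leftRegular m₁ s x ⊗ₜ leftRegular m₂ t y))
    {ν : Measure (G₁ × G₂)} {h : G₁ × G₂ → ℂ} (hh : Integrable h ν) (η ξ : Lp ℂ 2 m₂) :
    slice W η ξ (measureOperator m (ν.withDensityᵥ h)) =
      measureOperator m₁
        ((ν.withDensityᵥ fun p => h p * inner ℂ η (leftRegular m₂ p.2 ξ)).map Prod.fst) := by
  have hi := integrable_mul_inner_leftRegular_snd hh η ξ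
  ext1 x
  refine ext_inner_left ℂ fun u => ?_
  rw [inner_slice, inner_measureOperator_withDensityᵥ m hh,
    inner_measureOperator_map m₁ hi measurable_fst]
  refine integral_congr_ae (Filter.Eventually.of_forall fun p => ?_)
  simp only [inner_leftRegular_tmul hWl]
  ring

/-- The marginal of an absolutely continuous complex measure is absolutely continuous. -/
theorem exists_withDensityᵥ_eq_map_fst {X Y : Type*} [MeasurableSpace X] [MeasurableSpace Y]
    {μ : Measure X} {ν : Measure Y} [SFinite μ] [SFinite ν] {c : ℝ≥0} (hc : c ≠ 0)
    {k : X × Y → ℂ} (hk : Integrable k (c • μ.prod ν)) :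
    ∃ f : X → ℂ, Integrable f μ ∧ ((c • μ.prod ν).withDensityᵥ k).map Prod.fst =
      μ.withDensityᵥ f := by
  have hk' : Integrable k (μ.prod ν) := by
    have := hk.smul_measure_nnreal (c := c⁻¹)
    rwa [smul_smul, inv_mul_cancel₀ hc, one_smul] at this
  have hi : Integrable (fun s => ((c : ℝ) : ℂ) * ∫ t, k (s, t) ∂ν) μ :=
    hk'.integral_prod_left.const_mul _
  refine ⟨_, hi, ?_⟩
  ext s hs : 1
  rw [VectorMeasure.map_apply _ measurable_fst hs, withDensityᵥ_apply hk (measurable_fst hs),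
    withDensityᵥ_apply hi hs, integral_const_mul, Measure.restrict_smul,
    integral_smul_nnreal_measure, ← Set.prod_univ, setIntegral_prod _ hk'.integrableOn,
    NNReal.smul_def, Complex.real_smul]
  simp only [Measure.restrict_univ]

/-- Slice maps are norm continuous and send `λ(L¹(G₁ × G₂))` into `λ(L¹(G₁))`. -/
theorem slice_mem_reducedCStar
    (hWl : ∀ s t x y, leftRegular m (s, t) (W (x ⊗ₜ y)) =
      W (leftRegular m₁ s x ⊗ₜ leftRegular m₂ t y)) (η ξ : Lp ℂ 2 m₂)
    {C : Lp ℂ 2 m →L[ℂ] Lp ℂ 2 m} (hC : C ∈ reducedCStar m) :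
    slice W η ξ C ∈ reducedCStar m₁ := by
  refine map_mem_closure (continuous_slice η ξ) hC ?_
  rintro _ ⟨f, hf, rfl⟩
  have hi := integrable_mul_inner_leftRegular_snd hf η ξ
  rw [slice_measureOperator hWl hf]
  obtain ⟨c, hc, hcm⟩ := exists_smul_prod_eq m₁ m₂ m
  obtain ⟨F, hF, e⟩ := exists_withDensityᵥ_eq_map_fst hc (hcm ▸ hi)
  refine ⟨F, hF, ?_⟩
  rw [← e, ← hcm]

/-- If `A` and `B` lie in the reduced C*-algebras of the factors, the operator `C = A ⊗ B` lies in
that of the product: approximate `A` by `λ(fₙ)` and `B` by `λ(gₙ)`; then `λ(fₙ ⊗ gₙ)` tends to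
`A ⊗ B`. -/
theorem tensor_mem_reducedCStar (hW : DenseRange W)
    (hWl : ∀ s t x y, leftRegular m (s, t) (W (x ⊗ₜ y)) =
      W (leftRegular m₁ s x ⊗ₜ leftRegular m₂ t y))
    {A : Lp ℂ 2 m₁ →L[ℂ] Lp ℂ 2 m₁} {B : Lp ℂ 2 m₂ →L[ℂ] Lp ℂ 2 m₂}
    {C : Lp ℂ 2 m →L[ℂ] Lp ℂ 2 m} (hA : A ∈ reducedCStar m₁) (hB : B ∈ reducedCStar m₂)
    (hC : ∀ x y, C (W (x ⊗ₜ y)) = W (A x ⊗ₜ B y)) : C ∈ reducedCStar m := by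
  obtain ⟨A', hA', hAlim⟩ := mem_closure_iff_seq_limit.1 hA
  obtain ⟨B', hB', hBlim⟩ := mem_closure_iff_seq_limit.1 hB
  choose f hf hfA using hA'
  choose g hg hgB using hB'
  obtain ⟨c, hc, hcm⟩ := exists_smul_prod_eq m₁ m₂ m
  have hi (n : ℕ) : Integrable (fun p => f n p.1 * g n p.2) (m₁.prod m₂) :=
    (hf n).mul_prod (hg n)
  refine mem_closure_iff_seq_limit.2 ⟨fun n => measureOperator m
    ((m₁.prod m₂).withDensityᵥ fun p => f n p.1 * g n p.2), fun n => ?_,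
    tendsto_of_tensor hW hAlim hBlim (fun n x y => ?_) hC⟩
  -- the factor `c⁻¹` compensates for the normalization `m = c • m₁ × m₂`
  · refine ⟨fun p => ((c : ℝ) : ℂ)⁻¹ * (f n p.1 * g n p.2), ?_, ?_⟩
    · rw [hcm]
      exact ((hi n).const_mul _).smul_measure_nnreal
    · change measureOperator m ((m₁.prod m₂).withDensityᵥ fun p => f n p.1 * g n p.2) = _
      rw [← withDensityᵥ_smul_measure hc (hi n), ← hcm]
  · rw [hfA, hgB]
    exact measureOperator_prod hW hWl (hf n) (hg n) x y

end Product

/-! ### Products of sets of multiplicity and of uniqueness -/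

section Product

variable {G₁ : Type*} [Group G₁] [TopologicalSpace G₁] [IsTopologicalGroup G₁]
  [LocallyCompactSpace G₁] [SecondCountableTopology G₁] [MeasurableSpace G₁] [BorelSpace G₁]
  {G₂ : Type*} [Group G₂] [TopologicalSpace G₂] [IsTopologicalGroup G₂]
  [LocallyCompactSpace G₂] [SecondCountableTopology G₂] [MeasurableSpace G₂] [BorelSpace G₂]
  {m₁ : Measure G₁} [m₁.IsHaarMeasure] {m₂ : Measure G₂} [m₂.IsHaarMeasure]
  {m : Measure (G₁ × G₂)} [m.IsHaarMeasure] {E₁ : Set G₁} {E₂ : Set G₂}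

/-- The product measure `μ₁ × μ₂` of two witnesses is a witness for the product set. -/
theorem IsRestrictedMultiplicitySet.prod (h₁ : IsRestrictedMultiplicitySet m₁ E₁)
    (h₂ : IsRestrictedMultiplicitySet m₂ E₂) : IsRestrictedMultiplicitySet m (E₁ ×ˢ E₂) := by
  obtain ⟨hE₁, hn₁⟩ := h₁
  obtain ⟨hE₂, hn₂⟩ := h₂
  refine ⟨hE₁.prod hE₂, ?_⟩
  rw [isExtendedUniquenessSet_iff _ hE₁] at hn₁
  rw [isExtendedUniquenessSet_iff _ hE₂] at hn₂
  rw [isExtendedUniquenessSet_iff _ (hE₁.prod hE₂)]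
  push Not at hn₁ hn₂ ⊢
  obtain ⟨μ₁, hμ₁, hr₁, hne₁⟩ := hn₁
  obtain ⟨μ₂, hμ₂, hr₂, hne₂⟩ := hn₂
  obtain ⟨W, hW, hWl⟩ := exists_tensor_leftRegular m₁ m₂ m
  obtain ⟨k₁, hk₁, e₁⟩ := exists_density_variation μ₁
  obtain ⟨k₂, hk₂, e₂⟩ := exists_density_variation μ₂
  have := isFiniteMeasure_variation μ₁
  have := isFiniteMeasure_variation μ₂
  have hop := measureOperator_prod hW hWl hk₁ hk₂
  rw [← e₁, ← e₂] at hop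
  refine ⟨_, ?_, tensor_mem_reducedCStar hW hWl hr₁ hr₂ hop, fun h0 => ?_⟩
  · rw [mem_measuresSupportedOn_iff (hE₁.prod hE₂),
      Measure.variation_withDensityᵥ (hk₁.mul_prod hk₂)]
    refine withDensity_absolutelyContinuous _ _ ?_
    rw [mem_measuresSupportedOn_iff hE₁] at hμ₁
    rw [mem_measuresSupportedOn_iff hE₂] at hμ₂
    rw [Set.compl_prod_eq_union, measure_union_null_iff, Measure.prod_prod, Measure.prod_prod,
      hμ₁, hμ₂, zero_mul, mul_zero]
    exact ⟨rfl, rfl⟩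
  · obtain ⟨x, hx⟩ := DFunLike.ne_iff.1 hne₁
    obtain ⟨y, hy⟩ := DFunLike.ne_iff.1 hne₂
    have h := congrArg norm (hop x y)
    rw [h0, W.norm_map, TensorProduct.norm_tmul] at h
    exact mul_ne_zero (norm_ne_zero_iff.2 hx) (norm_ne_zero_iff.2 hy) (by simpa using h.symm)

/-- The slices of `λ(μ)` along `G₂` are operators of measures supported on `E₁`, hence vanish. -/
theorem IsExtendedUniquenessSet.prod_left (m₂ : Measure G₂) [m₂.IsHaarMeasure]
    (h₁ : IsExtendedUniquenessSet m₁ E₁) (hE₂ : IsClosed E₂) :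
    IsExtendedUniquenessSet m (E₁ ×ˢ E₂) := by
  have hE₁ := h₁.1
  rw [isExtendedUniquenessSet_iff _ hE₁] at h₁
  rw [isExtendedUniquenessSet_iff _ (hE₁.prod hE₂)]
  intro μ hμ hr
  rw [mem_measuresSupportedOn_iff (hE₁.prod hE₂)] at hμ
  obtain ⟨W, hW, hWl⟩ := exists_tensor_leftRegular m₁ m₂ m
  obtain ⟨k, hk, e⟩ := exists_density_variation μ
  refine eq_zero_of_slice_eq_zero hW fun η ξ => ?_
  have hs := slice_measureOperator hWl hk η ξ
  rw [← e] at hs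
  rw [hs]
  refine h₁ _ ?_ (hs ▸ slice_mem_reducedCStar hWl η ξ hr)
  rw [mem_measuresSupportedOn_iff hE₁]
  have hi := integrable_mul_inner_leftRegular_snd hk η ξ
  refine le_antisymm ((VectorMeasure.variation_map_le _).trans_eq ?_) zero_le
  rw [Measure.map_apply measurable_fst hE₁.measurableSet.compl, Measure.variation_withDensityᵥ hi]
  refine withDensity_absolutelyContinuous _ _ (measure_mono_null ?_ hμ)
  exact fun p hp hp' => hp hp'.1

end Product

theorem corollary3p12
    {G₁ : Type*} [Group G₁] [TopologicalSpace G₁] [IsTopologicalGroup G₁] [T2Space G₁]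
    [LocallyCompactSpace G₁] [SecondCountableTopology G₁] [MeasurableSpace G₁] [BorelSpace G₁]
    {G₂ : Type*} [Group G₂] [TopologicalSpace G₂] [IsTopologicalGroup G₂] [T2Space G₂]
    [LocallyCompactSpace G₂] [SecondCountableTopology G₂] [MeasurableSpace G₂] [BorelSpace G₂]
    (m₁ : Measure G₁) [m₁.IsHaarMeasure] (m₂ : Measure G₂) [m₂.IsHaarMeasure]
    (m : Measure (G₁ × G₂)) [m.IsHaarMeasure]
    (E₁ : Set G₁) (hE₁ : IsClosed E₁) (E₂ : Set G₂) (hE₂ : IsClosed E₂) :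
    (IsRestrictedMultiplicitySet m₁ E₁ → IsRestrictedMultiplicitySet m₂ E₂ →
      IsRestrictedMultiplicitySet m (E₁ ×ˢ E₂)) ∧
    (IsExtendedUniquenessSet m₁ E₁ → IsExtendedUniquenessSet m₂ E₂ →
      IsExtendedUniquenessSet m (E₁ ×ˢ E₂)) :=
  ⟨fun h₁ h₂ => h₁.prod h₂, fun h₁ _ => h₁.prod_left m₂ hE₂⟩
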